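/- A \emph{dessin} is given by a finite non-empty set $E$ (its edges) together with permutations $x, y$ of $E$ (the rotations of the edges around the black and white vertices) such that the \emph{monodromy group} $\langle x,y\rangle$ is transitive on $E$; put $z=(xy)^{-1}$, where permutations are composed from left to right, so that $xyz=1$. The \emph{degree} is $|E|$. The dessin has \emph{type} $(l,m,n)$ if all cycle lengths of $x$, $y$, $z$ (the orders of the branch points over $0$, $1$, $\infty$) divide $l$, $m$, $n$ respectively; the type is \emph{exact} if $l,m,n$ are the least common multiples of these cycle lengths, that is, the orders of $x,y,z$. An isomorphism of dessins is a bijection between the edge sets that commutes with $x$ and $y$; the \emph{automorphism group} consists of the permutations of $E$ that commute with $x$ and $y$, and the dessin is \emph{regular} if this group is transitive on $E$. The \emph{minimal regular cover} of a dessin with monodromy group $G$ is the dessin with edge set $G$ on which $x$ and $y$ act by $g\mapsto gx$ and $g\mapsto gy$. For a prime $p$ let $\mathcal D_0(p)$ be the dessin whose edges are the points of the projective line $\mathbb P^1(\mathbb F_p)$, with $$x: t\mapsto \frac{-1}{t-1},\qquad y: t\mapsto \frac{-1}{t},\qquad z: t\mapsto t+1,$$ and let $\mathcal D(p)$ be its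 minimal regular cover. \textbf{Theorem.} For each prime $p$: (i) $\mathcal D(p)$ is a regular dessin of type $(3,2,p)$, and its type is exact; its automorphism group is isomorphic to $\mathrm{PSL}_2(p)$; and every regular dessin of type $(3,2,p)$ with automorphism group isomorphic to $\mathrm{PSL}_2(p)$ is isomorphic to $\mathcal D(p)$. (ii) $\mathcal D_0(p)$ is a dessin of degree $p+1$ and type $(3,2,p)$, and its type is exact; its monodromy group is isomorphic to $\mathrm{PSL}_2(p)$; and every dessin of degree $p+1$ and type $(3,2,p)$ with monodromy group isomorphic to $\mathrm{PSL}_2(p)$ is isomorphic to $\mathcal D_0(p)$. -/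

import Mathlib

universe u v

/-- A dessin d'enfant, given by its edge set and its monodromy permutations: `x` and `y` rotate the
edges around their incident black and white vertices, following the orientation of the surface.
Finiteness of the edge set is compactness of the surface, transitivity of `⟨x, y⟩` is
connectedness. -/
structure Dessin where
  /-- the set of edges -/
  E : Type u
  finite : Finite E
  nonempty : Nonempty E
  /-- rotation around the black vertices -/
  x : Equiv.Perm E
  /-- rotation around the white vertices -/
  y : Equiv.Perm E
  transitive : MulAction.IsPretransitive (Subgroup.closure {x, y}) E

namespace Dessin

/-- The rotation around the faces, `z = (xy)⁻¹` where `xy` means: first `x`, then `y`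
(Lean composes permutations from right to left). -/
def z (D : Dessin.{u}) : Equiv.Perm D.E := (D.y * D.x)⁻¹

/-- The degree: the number of edges. -/
noncomputable def degree (D : Dessin.{u}) : ℕ := Nat.card D.E

/-- The monodromy group `⟨x, y⟩`, a group of permutations of the edges. -/
def monodromyGroup (D : Dessin.{u}) : Subgroup (Equiv.Perm D.E) := Subgroup.closure {D.x, D.y}

/-- The automorphism group: the permutations of the edges commuting with `x` and `y`. -/
def autGroup (D : Dessin.{u}) : Subgroup (Equiv.Perm D.E) := Subgroup.centralizer {D.x, D.y}

/-- A dessin is regular if its automorphism group is transitive on the edges. -/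
def IsRegular (D : Dessin.{u}) : Prop := MulAction.IsPretransitive D.autGroup D.E

/-- Type `(l, m, n)`: the orders of the branch points over `0`, `1`, `∞`, that is, the lengths of
all cycles of `x`, `y`, `z`, divide `l`, `m`, `n`. -/
def HasType (D : Dessin.{u}) (l m n : ℕ) : Prop :=
  orderOf D.x ∣ l ∧ orderOf D.y ∣ m ∧ orderOf D.z ∣ n

/-- Exact type `(l, m, n)`: the least common multiples of the orders of the branch points over
`0`, `1`, `∞`, that is, of the lengths of the cycles of `x`, `y`, `z`, are `l`, `m`, `n`. -/
def HasExactType (D : Dessin.{u}) (l m n : ℕ) : Prop :=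
  orderOf D.x = l ∧ orderOf D.y = m ∧ orderOf D.z = n

/-- Coverings of dessins: maps between the edge sets that commute with the monodromy permutations
(they are surjective by transitivity). -/
def IsCovering (R : Dessin.{u}) (D : Dessin.{v}) (f : R.E → D.E) : Prop :=
  (∀ e, f (R.x e) = D.x (f e)) ∧ ∀ e, f (R.y e) = D.y (f e)

/-- Isomorphism of dessins: a bijection of the edge sets that commutes with the monodromy
permutations. -/
def Isomorphic (D₁ : Dessin.{u}) (D₂ : Dessin.{v}) : Prop :=
  ∃ f : D₁.E ≃ D₂.E, IsCovering D₁ D₂ f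

/-- The minimal regular cover of `D`: its edges are the elements of the monodromy group of `D`,
permuted by multiplication by `x` and `y`. -/
def minimalRegularCover (D : Dessin.{u}) : Dessin.{u} where
  E := D.monodromyGroup
  finite := by
    have := D.finite
    infer_instance
  nonempty := ⟨1⟩
  x := Equiv.mulLeft ⟨D.x, Subgroup.subset_closure (by simp)⟩
  y := Equiv.mulLeft ⟨D.y, Subgroup.subset_closure (by simp)⟩
  transitive := by
    set X : D.monodromyGroup := ⟨D.x, Subgroup.subset_closure (by simp)⟩ with hX
    set Y : D.monodromyGroup := ⟨D.y, Subgroup.subset_closure (by simp)⟩ with hY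
    have key : ∀ g (hg : g ∈ D.monodromyGroup),
        Equiv.mulLeft (⟨g, hg⟩ : D.monodromyGroup) ∈
          Subgroup.closure {Equiv.mulLeft X, Equiv.mulLeft Y} := by
      intro g hg
      induction hg using Subgroup.closure_induction with
      | mem a ha =>
        rcases ha with rfl | rfl
        · exact Subgroup.subset_closure (Set.mem_insert _ _)
        · exact Subgroup.subset_closure (Set.mem_insert_of_mem _ rfl)
      | one =>
        have : Equiv.mulLeft (1 : D.monodromyGroup) = 1 := by ext; simp
        exact this ▸ Subgroup.one_mem _
      | mul a b ha hb iha ihb =>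
        have : Equiv.mulLeft (⟨a * b, Subgroup.mul_mem _ ha hb⟩ : D.monodromyGroup)
            = Equiv.mulLeft (⟨a, ha⟩ : D.monodromyGroup) * Equiv.mulLeft ⟨b, hb⟩ := by
          ext; simp
        exact this ▸ Subgroup.mul_mem _ iha ihb
      | inv a ha iha =>
        have : Equiv.mulLeft (⟨a⁻¹, Subgroup.inv_mem _ ha⟩ : D.monodromyGroup)
            = (Equiv.mulLeft (⟨a, ha⟩ : D.monodromyGroup))⁻¹ := by
          ext; simp
        exact this ▸ Subgroup.inv_mem _ iha
    refine ⟨fun a b => ⟨⟨Equiv.mulLeft (b * a⁻¹), key _ (b * a⁻¹).2⟩, ?_⟩⟩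
    change b * a⁻¹ * a = b
    group

/-- The minimal regular cover is regular. -/
theorem minimalRegularCover_isRegular (D : Dessin.{u}) : D.minimalRegularCover.IsRegular := by
  refine ⟨fun (a b : D.monodromyGroup) => ?_⟩
  let s : Equiv.Perm D.minimalRegularCover.E :=
    (Equiv.mulRight (a⁻¹ * b) : Equiv.Perm D.monodromyGroup)
  have hs : s ∈ D.minimalRegularCover.autGroup := by
    rw [autGroup, Subgroup.mem_centralizer_iff]
    rintro h (rfl | rfl)
    · exact Equiv.ext fun c => (mul_assoc (G := D.monodromyGroup) _ _ _).symm
    · exact Equiv.ext fun c => (mul_assoc (G := D.monodromyGroup) _ _ _).symm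
  exact ⟨⟨s, hs⟩, mul_inv_cancel_left (G := D.monodromyGroup) a b⟩

/-- The minimal regular cover covers `D`. -/
theorem minimalRegularCover_isCovering (D : Dessin.{u}) (e₀ : D.E) :
    IsCovering D.minimalRegularCover D (fun g : D.monodromyGroup => g.1 e₀) :=
  ⟨fun _ => rfl, fun _ => rfl⟩

/-- The minimal regular cover is minimal: every covering of `D` by a regular dessin factors
through it. -/
theorem minimalRegularCover_minimal (D : Dessin.{u}) (e₀ : D.E) (R : Dessin.{v})
    (hR : R.IsRegular) (f : R.E → D.E) (hf : IsCovering R D f) :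
    ∃ h : R.E → D.minimalRegularCover.E, IsCovering R D.minimalRegularCover h ∧
      ∀ e, (h e : D.monodromyGroup).1 e₀ = f e := by
  classical
  obtain ⟨e₁⟩ := R.nonempty
  let K : Subgroup (Equiv.Perm R.E × Equiv.Perm D.E) :=
    Subgroup.closure {(R.x, D.x), (R.y, D.y)}
  have hx : (R.x, D.x) ∈ K := Subgroup.subset_closure (by simp)
  have hy : (R.y, D.y) ∈ K := Subgroup.subset_closure (by simp)
  have eqv : ∀ k ∈ K, ∀ e, f (k.1 e) = k.2 (f e) := by
    intro k hk
    induction hk using Subgroup.closure_induction with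
    | mem a ha =>
      rcases ha with rfl | rfl
      · exact hf.1
      · exact hf.2
    | one => intro e; rfl
    | mul a b _ _ iha ihb => intro e; simp [iha, ihb]
    | inv a _ iha =>
      intro e
      have := iha (a.1⁻¹ e)
      simp only [Prod.fst_inv, Prod.snd_inv]
      rw [Equiv.Perm.eq_inv_iff_eq, ← this]
      simp
  have fst_eq : K.map (MonoidHom.fst _ _) = R.monodromyGroup := by
    rw [MonoidHom.map_closure, monodromyGroup, Set.image_pair]; rfl
  have snd_eq : K.map (MonoidHom.snd _ _) = D.monodromyGroup := by
    rw [MonoidHom.map_closure, monodromyGroup, Set.image_pair]; rfl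
  have comm : ∀ g ∈ R.monodromyGroup, ∀ s ∈ R.autGroup, ∀ e, g (s e) = s (g e) := by
    intro g hg s hs e
    have h1 : R.monodromyGroup ≤ Subgroup.centralizer {s} := by
      rw [monodromyGroup, Subgroup.closure_le]
      intro t ht
      rw [SetLike.mem_coe, Subgroup.mem_centralizer_singleton_iff]
      exact (Subgroup.mem_centralizer_iff.1 hs t ht)
    have h2 := Subgroup.mem_centralizer_singleton_iff.1 (h1 hg)
    exact congrArg (fun t : Equiv.Perm R.E => t e) h2
  have ex : ∀ e, ∃ k ∈ K, k.1 e₁ = e := by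
    intro e
    obtain ⟨⟨g, hg⟩, hge⟩ := R.transitive.exists_smul_eq e₁ e
    rw [← monodromyGroup, ← fst_eq] at hg
    obtain ⟨k, hk, rfl⟩ := hg
    exact ⟨k, hk, hge⟩
  have ex' : ∀ d, ∃ g ∈ D.monodromyGroup, g e₀ = d := by
    intro d
    obtain ⟨⟨g, hg⟩, hge⟩ := D.transitive.exists_smul_eq e₀ d
    exact ⟨g, hg, hge⟩
  have surj : Function.Surjective f := by
    intro d
    obtain ⟨⟨g, hg⟩, hge⟩ := D.transitive.exists_smul_eq (f e₁) d
    rw [← monodromyGroup, ← snd_eq] at hg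
    obtain ⟨k, hk, rfl⟩ := hg
    exact ⟨k.1 e₁, (eqv k hk e₁).trans hge⟩
  have uniq : ∀ k ∈ K, ∀ l ∈ K, k.1 e₁ = l.1 e₁ → k.2 = l.2 := by
    intro k hk l hl hkl
    have hk' : k.1 ∈ R.monodromyGroup := fst_eq ▸ Subgroup.mem_map_of_mem _ hk
    have hl' : l.1 ∈ R.monodromyGroup := fst_eq ▸ Subgroup.mem_map_of_mem _ hl
    ext d
    obtain ⟨e, rfl⟩ := surj d
    obtain ⟨⟨s, hs⟩, hse⟩ := hR.exists_smul_eq e₁ e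
    have hse' : s e₁ = e := hse
    rw [← eqv k hk, ← eqv l hl, ← hse', comm _ hk' _ hs, comm _ hl' _ hs, hkl]
  choose k hk hke using ex
  obtain ⟨g, hg, hge⟩ := ex' (f e₁)
  have mem : ∀ e, (k e).2 * g ∈ D.monodromyGroup := fun e =>
    Subgroup.mul_mem _ (snd_eq ▸ Subgroup.mem_map_of_mem _ (hk e)) hg
  refine ⟨fun e => (⟨(k e).2 * g, mem e⟩ : D.monodromyGroup), ⟨fun e => ?_, fun e => ?_⟩,
    fun e => ?_⟩
  · refine Subtype.ext ?_
    change (k (R.x e)).2 * g = D.x * ((k e).2 * g)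
    rw [← mul_assoc, uniq _ (hk _) _ (K.mul_mem hx (hk e)) (by simp [hke])]
    rfl
  · refine Subtype.ext ?_
    change (k (R.y e)).2 * g = D.y * ((k e).2 * g)
    rw [← mul_assoc, uniq _ (hk _) _ (K.mul_mem hy (hk e)) (by simp [hke])]
    rfl
  · change (k e).2 (g e₀) = f e
    rw [hge, ← eqv _ (hk e), hke]

end Dessin

open scoped LinearAlgebra.Projectivization MatrixGroups

/-- The permutation of the projective line over `𝔽_p` induced by a matrix in `SL₂(p)`: the matrix
with rows `(a, b)` and `(c, d)` acts as `t ↦ (a t + b) / (c t + d)`, where `t` stands for the point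
`[t : 1]` and `∞` for `[1 : 0]`. -/
def moebiusPerm (p : ℕ) [Fact p.Prime] (A : SL(2, ZMod p)) :
    Equiv.Perm (ℙ (ZMod p) (Fin 2 → ZMod p)) :=
  MulAction.toPerm A

/-- The modular dessin `𝒟₀(p)`: the edges are the points of the projective line over `𝔽_p`, and
`x : t ↦ -1 / (t - 1)`, `y : t ↦ -1 / t` (so that `z : t ↦ t + 1`). -/
def modularDessinZero (p : ℕ) [Fact p.Prime] : Dessin.{0} where
  E := ℙ (ZMod p) (Fin 2 → ZMod p)
  finite := inferInstance
  nonempty := inferInstance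
  x := moebiusPerm p ⟨!![0, -1; 1, -1], by simp [Matrix.det_fin_two]⟩
  y := moebiusPerm p ⟨!![0, -1; 1, 0], by simp [Matrix.det_fin_two]⟩
  transitive := by
    set X : SL(2, ZMod p) := ⟨!![0, -1; 1, -1], by simp [Matrix.det_fin_two]⟩ with hX
    set Y : SL(2, ZMod p) := ⟨!![0, -1; 1, 0], by simp [Matrix.det_fin_two]⟩ with hY
    have hx : moebiusPerm p X ∈ Subgroup.closure {moebiusPerm p X, moebiusPerm p Y} :=
      Subgroup.subset_closure (by simp)
    have hy : moebiusPerm p Y ∈ Subgroup.closure {moebiusPerm p X, moebiusPerm p Y} :=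
      Subgroup.subset_closure (by simp)
    have h1 : (![1, 0] : Fin 2 → ZMod p) ≠ 0 := fun h => by simpa using congrFun h 0
    have ht : ∀ t : ZMod p, (![t, 1] : Fin 2 → ZMod p) ≠ 0 := fun t h => by
      simpa using congrFun h 1
    have smulmk : ∀ (A : SL(2, ZMod p)) (v w : Fin 2 → ZMod p) (hv : v ≠ 0) (hw : w ≠ 0)
        (a : ZMod p), a • w = A.1.mulVec v →
          moebiusPerm p A (Projectivization.mk _ v hv) = Projectivization.mk _ w hw := by
      intro A v w hv hw a h
      exact (Projectivization.mk_eq_mk_iff' (ZMod p) (A.1.mulVec v) w _ hw).2 ⟨a, h⟩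
    have key : ∀ q : ℙ (ZMod p) (Fin 2 → ZMod p),
        ∃ g ∈ Subgroup.closure {moebiusPerm p X, moebiusPerm p Y},
          g (Projectivization.mk _ ![1, 0] h1) = q := by
      have fin : ∀ n : ℕ, ∃ g ∈ Subgroup.closure {moebiusPerm p X, moebiusPerm p Y},
          g (Projectivization.mk _ ![1, 0] h1) =
            Projectivization.mk _ ![-(n : ZMod p), 1] (ht _) := by
        intro n
        induction n with
        | zero =>
          refine ⟨_, hy, smulmk _ _ _ _ _ 1 ?_⟩
          ext i; fin_cases i <;> simp [hY]
        | succ n ih =>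
          obtain ⟨g, hg, hgq⟩ := ih
          refine ⟨_, Subgroup.mul_mem _ hy (Subgroup.mul_mem _ hx hg), ?_⟩
          have h2 : (![-1, -(n : ZMod p) - 1] : Fin 2 → ZMod p) ≠ 0 := fun h => by
            simpa using congrFun h 0
          rw [Equiv.Perm.mul_apply, Equiv.Perm.mul_apply, hgq,
            smulmk X _ ![-1, -(n : ZMod p) - 1] (ht _) h2 1
              (by ext i; fin_cases i <;> simp [hX, sub_eq_add_neg])]
          refine smulmk _ _ _ _ _ (-1) ?_
          ext i; fin_cases i <;> simp [hY]; ring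
      intro q
      induction q using Projectivization.ind with
      | h v hv =>
        by_cases h : v 1 = 0
        · refine ⟨1, Subgroup.one_mem _, ?_⟩
          rw [Equiv.Perm.one_apply, Projectivization.mk_eq_mk_iff']
          have h0 : v 0 ≠ 0 := fun h0 => hv (by ext i; fin_cases i <;> simp [h, h0])
          exact ⟨(v 0)⁻¹, by ext i; fin_cases i <;> simp [h, h0]⟩
        · obtain ⟨g, hg, hgq⟩ := fin (-(v 0 / v 1)).val
          refine ⟨g, hg, hgq.trans ?_⟩
          rw [Projectivization.mk_eq_mk_iff']
          refine ⟨(v 1)⁻¹, ?_⟩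
          ext i; fin_cases i
          · simp [div_eq_mul_inv, mul_comm]
          · simp [h]
    refine ⟨fun q r => ?_⟩
    obtain ⟨g, hg, rfl⟩ := key q
    obtain ⟨k, hk, rfl⟩ := key r
    exact ⟨⟨k * g⁻¹, Subgroup.mul_mem _ hk (Subgroup.inv_mem _ hg)⟩, by
      change (k * g⁻¹) (g _) = _
      simp⟩

/-- The modular dessin `𝒟(p)`: the minimal regular cover of `𝒟₀(p)`. -/
def modularDessin (p : ℕ) [Fact p.Prime] : Dessin.{0} := (modularDessinZero p).minimalRegularCover

/-! Both uniqueness claims rest on one fact: the automorphisms of PSL₂(p) permute its generating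
triples of type (3, 2, p) transitively (`exists_mulEquiv_of_closure`). By Cayley-Hamilton such a
pair lifts to matrices with X² + X + 1 = 0 and Y² = -1. Over 𝔽_p, (YX)^p = ±1 forces YX to have an
eigenvalue ±1, and after a change of sign of Y there is u ≠ 0 with YXu = -u. Then Xu = Yu =: v, and
in the basis (u, v) both matrices take their standard form. The change of basis lies in GL₂ and
induces an automorphism of PSL₂.

For (i), the monodromy group of a regular dessin acts freely, so the dessin is determined by its
monodromy triple, and its automorphism group is isomorphic to its monodromy group. For (ii), the
point stabilizer must also be identified. Having order dividing p on p + 1 points, z fixes an edge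
e. The preimage of its stabilizer in SL₂(p) contains the translation t ↦ t + 1. If it also moved ∞
it would be everything (`eq_top_of_upper_one_mem`), contradicting transitivity. Hence it fixes ∞,
which gives a covering of 𝒟₀(p), bijective because the degrees agree. -/

namespace ModularDessin

/-! ### Generation of SL₂(p) by elementary matrices and by the standard pair -/

/-- The matrix of `t ↦ -1 / (t - 1)`. -/
def matX (R : Type*) [CommRing R] : SL(2, R) := ⟨!![0, -1; 1, -1], by simp [Matrix.det_fin_two]⟩

/-- The matrix of `t ↦ -1 / t`. -/
def matY (R : Type*) [CommRing R] : SL(2, R) := ⟨!![0, -1; 1, 0], by simp [Matrix.det_fin_two]⟩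

/-- The matrix of `t ↦ t + a`. -/
def upper {R : Type*} [CommRing R] (a : R) : SL(2, R) :=
  ⟨!![1, a; 0, 1], by simp [Matrix.det_fin_two]⟩

/-- The transpose of `upper a`. -/
def lower {R : Type*} [CommRing R] (a : R) : SL(2, R) :=
  ⟨!![1, 0; a, 1], by simp [Matrix.det_fin_two]⟩

section CommRing

variable {R : Type*} [CommRing R]

@[simp] theorem coe_matX : (matX R : Matrix (Fin 2) (Fin 2) R) = !![0, -1; 1, -1] := rfl

@[simp] theorem coe_matY : (matY R : Matrix (Fin 2) (Fin 2) R) = !![0, -1; 1, 0] := rfl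

@[simp] theorem coe_upper (a : R) : (upper a : Matrix (Fin 2) (Fin 2) R) = !![1, a; 0, 1] := rfl

@[simp] theorem coe_lower (a : R) : (lower a : Matrix (Fin 2) (Fin 2) R) = !![1, 0; a, 1] := rfl

theorem upper_mul (a b : R) : upper a * upper b = upper (a + b) := by
  ext i j; fin_cases i <;> fin_cases j <;> simp [add_comm]

theorem upper_pow (a : R) (n : ℕ) : upper a ^ n = upper (n * a) := by
  induction n with
  | zero => ext i j; fin_cases i <;> fin_cases j <;> simp
  | succ n ih => rw [pow_succ, ih, upper_mul]; congr 1; push_cast; ring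

theorem matY_sq : matY R * matY R = -1 := by
  ext i j; fin_cases i <;> fin_cases j <;> simp

theorem matX_pow_three : matX R ^ 3 = 1 := by
  ext i j; fin_cases i <;> fin_cases j <;> simp [pow_succ]

theorem matY_mul_matX_inv : (matY R * matX R)⁻¹ = -upper 1 := by
  rw [inv_eq_iff_mul_eq_one]
  ext i j; fin_cases i <;> fin_cases j <;> simp

theorem neg_one_mem_center : (-1 : SL(2, R)) ∈ Subgroup.center SL(2, R) :=
  Subgroup.mem_center_iff.2 fun g => by simp

end CommRing

theorem mem_center_iff {F : Type*} [Field F] {A : SL(2, F)} :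
    A ∈ Subgroup.center SL(2, F) ↔ A = 1 ∨ A = -1 := by
  constructor
  · intro h
    obtain ⟨r, hr, hA⟩ := Matrix.SpecialLinearGroup.mem_center_iff.1 h
    rw [Fintype.card_fin, sq_eq_one_iff] at hr
    rcases hr with rfl | rfl
    · left; ext i j; simp [← hA]
    · right; ext i j; fin_cases i <;> fin_cases j <;> simp [← hA]
  · rintro (rfl | rfl)
    · exact Subgroup.one_mem _
    · exact neg_one_mem_center

theorem eq_top_of_upper_of_lower {F : Type*} [Field F] {K : Subgroup SL(2, F)}
    (hU : ∀ a, upper a ∈ K) (hL : ∀ a, lower a ∈ K) : K = ⊤ := by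
  refine eq_top_iff.2 fun M _ => Matrix.SL2.transvection_induction (· ∈ K) ?_ (fun _ _ => mul_mem) M
  intro i j hij a
  fin_cases i <;> fin_cases j
  · exact absurd rfl hij
  · convert! hU a using 1
    ext i j; fin_cases i <;> fin_cases j <;>
      simp [Matrix.SpecialLinearGroup.transvection, Matrix.transvection]
  · convert! hL a using 1
    ext i j; fin_cases i <;> fin_cases j <;>
      simp [Matrix.SpecialLinearGroup.transvection, Matrix.transvection]
  · exact absurd rfl hij

section Prime

variable {p : ℕ} [Fact p.Prime]

theorem upper_mem {K : Subgroup SL(2, ZMod p)} (h1 : upper 1 ∈ K) (a : ZMod p) : upper a ∈ K := by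
  have := K.pow_mem h1 a.val
  rwa [upper_pow, ZMod.natCast_val, ZMod.cast_id, mul_one] at this

/-- A subgroup of `SL₂(p)` containing the translation `t ↦ t + 1` and moving `∞` is the whole
group. -/
theorem eq_top_of_upper_one_mem {K : Subgroup SL(2, ZMod p)} (h1 : upper 1 ∈ K)
    {A : SL(2, ZMod p)} (hA : A ∈ K) (hA0 : A.1 1 0 ≠ 0) : K = ⊤ := by
  have hU := upper_mem h1
  refine eq_top_of_upper_of_lower hU fun s => ?_
  set c := A.1 1 0 with hc
  have hdet : A.1 0 0 * A.1 1 1 - A.1 0 1 * c = 1 := by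
    rw [hc, ← Matrix.det_fin_two]; exact A.2
  -- The two translations clear the diagonal of `A`, leaving an antidiagonal matrix, which
  -- conjugates upper unipotents into lower ones.
  set B := upper (-A.1 0 0 / c) * A * upper (-A.1 1 1 / c) with hB
  have hBK : B ∈ K := K.mul_mem (K.mul_mem (hU _) hA) (hU _)
  have hBm : B.1 = !![0, -c⁻¹; c, 0] := by
    simp only [hB, Matrix.SpecialLinearGroup.coe_mul, coe_upper]
    rw [Matrix.eta_fin_two A.1, ← hc]
    ext i j
    fin_cases i <;> fin_cases j <;> simp <;> field_simp
    · ring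
    · linear_combination -hdet
    · ring
  have : lower s = B * upper (-s / c ^ 2) * B⁻¹ := by
    rw [eq_mul_inv_iff_mul_eq]
    ext i j
    simp only [Matrix.SpecialLinearGroup.coe_mul, hBm]
    fin_cases i <;> fin_cases j <;> simp
    field_simp
  rw [this]
  exact K.mul_mem (K.mul_mem hBK (hU _)) (K.inv_mem hBK)

theorem closure_matX_matY : Subgroup.closure {matX (ZMod p), matY (ZMod p)} = ⊤ := by
  set K := Subgroup.closure {matX (ZMod p), matY (ZMod p)}
  have hx : matX (ZMod p) ∈ K := Subgroup.subset_closure (by simp)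
  have hy : matY (ZMod p) ∈ K := Subgroup.subset_closure (by simp)
  refine eq_top_of_upper_one_mem ?_ hy (by simp)
  -- The factor Y² = -1 cancels the sign in (YX)⁻¹ = -`upper 1`.
  have := K.mul_mem (K.mul_mem hy hy) (K.inv_mem (K.mul_mem hy hx))
  rwa [matY_mul_matX_inv, matY_sq, neg_mul_neg, one_mul] at this

end Prime

end ModularDessin

/-! ### Generating triples of PSL₂ up to automorphism -/

namespace ModularDessin

section Field

variable {F : Type*} [Field F]

theorem neg_mk (A : SL(2, F)) : ((-A : SL(2, F)) : PSL(2, F)) = A := by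
  rw [QuotientGroup.eq]
  simpa using neg_one_mem_center

theorem mk_eq_one_iff {A : SL(2, F)} : (A : PSL(2, F)) = 1 ↔ A = 1 ∨ A = -1 := by
  rw [QuotientGroup.eq_one_iff, mem_center_iff]

theorem mk_eq_one_of_eq_smul {A : SL(2, F)} {r : F} (h : A.1 = r • 1) : (A : PSL(2, F)) = 1 := by
  rw [QuotientGroup.eq_one_iff, Matrix.SpecialLinearGroup.mem_center_iff]
  refine ⟨r, ?_, ?_⟩
  · have := A.2
    rw [h] at this
    simpa using this
  · rw [h, Matrix.scalar_apply, Matrix.smul_one_eq_diagonal]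

/-- The Cayley-Hamilton theorem for `SL₂`. -/
theorem sq_eq (A : SL(2, F)) : A.1 * A.1 = A.1.trace • A.1 - 1 := by
  have hdet := A.2
  rw [Matrix.det_fin_two] at hdet
  ext i j
  fin_cases i <;> fin_cases j <;>
    simp [Matrix.mul_apply, Fin.sum_univ_two, Matrix.trace_fin_two]
  · linear_combination -hdet
  · ring
  · ring
  · linear_combination -hdet

/-- Since Y² = tY - 1 with t the trace, a scalar Y² with t ≠ 0 would make Y itself scalar, hence
trivial in PSL₂. So t = 0. -/
theorem coe_sq_of_mk_sq {Y : SL(2, F)} (h : (Y : PSL(2, F)) ^ 2 = 1) (h1 : (Y : PSL(2, F)) ≠ 1) :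
    Y.1 * Y.1 = -1 := by
  have h2 : ∃ r : F, Y.1 * Y.1 = r • 1 := by
    rw [← QuotientGroup.mk_pow, mk_eq_one_iff, pow_two] at h
    rcases h with h | h
    · exact ⟨1, by simpa using congrArg Subtype.val h⟩
    · exact ⟨-1, by simpa using congrArg Subtype.val h⟩
  obtain ⟨r, hr⟩ := h2
  have hY := sq_eq Y
  by_cases ht : Y.1.trace = 0
  · simpa [ht] using hY
  · refine absurd (mk_eq_one_of_eq_smul (r := (r + 1) / Y.1.trace) ?_) h1
    rw [hr] at hY
    rw [div_eq_inv_mul, mul_smul, add_smul, hY]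
    simp [smul_smul, ht]

/-- Cayley-Hamilton gives X³ = (t² - 1)X - t with t the trace. As X³ is scalar and X is not, t = ±1.
-/
theorem coe_cube_of_mk_cube {X : SL(2, F)} (h : (X : PSL(2, F)) ^ 3 = 1)
    (h1 : (X : PSL(2, F)) ≠ 1) :
    X.1 * X.1 = -X.1 - 1 ∨ X.1 * X.1 = X.1 - 1 := by
  have h2 : ∃ r : F, X.1 * X.1 * X.1 = r • 1 := by
    rw [← QuotientGroup.mk_pow, mk_eq_one_iff, pow_succ, pow_two] at h
    rcases h with h | h
    · exact ⟨1, by simpa using congrArg Subtype.val h⟩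
    · exact ⟨-1, by simpa using congrArg Subtype.val h⟩
  obtain ⟨r, hr⟩ := h2
  have hX := sq_eq X
  set t := X.1.trace
  have h3 : (t ^ 2 - 1) • X.1 = (t + r) • 1 := by
    rw [hX, sub_mul, smul_mul_assoc, hX, one_mul] at hr
    rw [add_smul, ← hr, sub_smul, pow_two, mul_smul, one_smul, smul_sub]
    abel
  by_cases ht : t ^ 2 - 1 = 0
  · rw [sub_eq_zero, sq_eq_one_iff] at ht
    rcases ht with ht | ht
    · right; simpa [ht] using hX
    · left; simpa [ht] using hX
  · refine absurd (mk_eq_one_of_eq_smul (r := (t + r) / (t ^ 2 - 1)) ?_) h1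
    rw [div_eq_inv_mul, mul_smul, ← h3, smul_smul, inv_mul_cancel₀ ht, one_smul]

/-- Every non-trivial element of order `3` of `PSL₂` lifts to one satisfying `X² + X + 1 = 0`. -/
theorem exists_lift_order_three {x : PSL(2, F)} (h : x ^ 3 = 1) (h1 : x ≠ 1) :
    ∃ X : SL(2, F), (X : PSL(2, F)) = x ∧ X.1 * X.1 = -X.1 - 1 := by
  obtain ⟨X, rfl⟩ := QuotientGroup.mk_surjective x
  rcases coe_cube_of_mk_cube h h1 with hX | hX
  · exact ⟨X, rfl, hX⟩
  · exact ⟨-X, neg_mk X, by simpa using hX⟩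

/-- Conjugation by an element of `GL₂`, as an automorphism of `SL₂`. -/
noncomputable def conjSL (g : GL (Fin 2) F) : SL(2, F) ≃* SL(2, F) where
  toFun A := ⟨g.1⁻¹ * A.1 * g.1, by
    rw [Matrix.det_mul_comm, ← mul_assoc]; simp⟩
  invFun A := ⟨g.1 * A.1 * g.1⁻¹, by
    rw [Matrix.det_mul_comm, ← mul_assoc]; simp⟩
  left_inv A := by
    ext1
    simp [mul_assoc]
  right_inv A := by
    ext1
    simp [mul_assoc]
  map_mul' A B := Subtype.ext (by
    change g.1⁻¹ * (A.1 * B.1) * g.1 = g.1⁻¹ * A.1 * g.1 * (g.1⁻¹ * B.1 * g.1)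
    simp [mul_assoc])

/-- Conjugation by an element of `GL₂`, as an automorphism of `PSL₂`. -/
noncomputable def conjPSL (g : GL (Fin 2) F) : PSL(2, F) ≃* PSL(2, F) :=
  QuotientGroup.congr _ _ (conjSL g)
    (Subgroup.characteristic_iff_map_eq.1 inferInstance _)

theorem conjPSL_mk {g : GL (Fin 2) F} {A B : SL(2, F)} (h : A.1 * g.1 = g.1 * B.1) :
    conjPSL g (A : PSL(2, F)) = B := by
  change ((conjSL g A : SL(2, F)) : PSL(2, F)) = B
  congr 1
  refine Subtype.ext ?_
  change g.1⁻¹ * A.1 * g.1 = B.1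
  rw [mul_assoc, h]
  simp [← mul_assoc]

/-- Two matrices satisfying the relations of the standard pair, with a common eigenvector of their
product, are simultaneously conjugate to the standard pair. -/
theorem exists_conj {X Y : SL(2, F)} (hX : X.1 * X.1 = -X.1 - 1) (hY : Y.1 * Y.1 = -1)
    {u : Fin 2 → F} (hu : u ≠ 0) (h : (Y.1 * X.1).mulVec u = -u) :
    ∃ g : GL (Fin 2) F, X.1 * g.1 = g.1 * (matX F).1 ∧ Y.1 * g.1 = g.1 * (matY F).1 := by
  have hYY : ∀ v, Y.1.mulVec (Y.1.mulVec v) = -v := fun v => by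
    rw [Matrix.mulVec_mulVec, hY, Matrix.neg_mulVec, Matrix.one_mulVec]
  -- Apply Y to YXu = -u and use Y² = -1.
  have hXu : X.1.mulVec u = Y.1.mulVec u := by
    rw [← Matrix.mulVec_mulVec] at h
    have := hYY (X.1.mulVec u)
    rw [h, Matrix.mulVec_neg] at this
    exact (neg_injective this).symm
  have hXX : X.1.mulVec (X.1.mulVec u) = -X.1.mulVec u - u := by
    rw [Matrix.mulVec_mulVec, hX, Matrix.sub_mulVec, Matrix.neg_mulVec, Matrix.one_mulVec]
  set v := Y.1.mulVec u with hv
  have hYv : Y.1.mulVec v = -u := hYY u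
  rw [hXu] at hXX
  -- Otherwise u is a common eigenvector with eigenvalue c, so c² + c + 1 = 0 = c² + 1. This gives c
  -- = 0 and then 1 = 0.
  have hli : ∀ c : F, v ≠ c • u := by
    intro c hc
    rw [hc, Matrix.mulVec_smul, hXu, hc] at hXX
    rw [hc, Matrix.mulVec_smul, ← hv, hc] at hYv
    have h1 : (c * c + c + 1) • u = 0 := by
      rw [add_smul, add_smul, mul_smul, hXX, one_smul]; abel
    have h2 : (c * c + 1) • u = 0 := by
      rw [add_smul, mul_smul, hYv, one_smul]; abel
    have h1' := (smul_eq_zero.1 h1).resolve_right hu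
    have h2' := (smul_eq_zero.1 h2).resolve_right hu
    have h3 : c = 0 := by linear_combination h1' - h2'
    simp [h3] at h2'
  have hdet : (Matrix.of ![u, v]).transpose.det ≠ 0 := by
    rw [Matrix.det_transpose]
    intro h0
    rw [Matrix.det_fin_two] at h0
    simp only [Matrix.of_apply, Matrix.cons_val_zero, Matrix.cons_val_one] at h0
    by_cases hu0 : u 0 = 0
    · have hu1 : u 1 ≠ 0 := fun hu1 => hu (by ext i; fin_cases i <;> simp [hu0, hu1])
      refine hli (v 1 / u 1) ?_
      ext i
      fin_cases i
      · simpa [hu0, hu1] using h0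
      · simp [hu1]
    · refine hli (v 0 / u 0) ?_
      ext i
      fin_cases i
      · simp [hu0]
      · simp; field_simp; linear_combination h0
  -- The matrix with columns u, v. The columns of the standard pair record Xu = v, Xv = -u - v and
  -- Yu = v, Yv = -u.
  refine ⟨Matrix.GeneralLinearGroup.mkOfDetNeZero _ hdet, ?_, ?_⟩
  · ext i j
    fin_cases j
    · simpa [Matrix.GeneralLinearGroup.mkOfDetNeZero, Matrix.mul_apply, Matrix.mulVec, dotProduct,
        Fin.sum_univ_two] using congrFun hXu i
    · simpa [Matrix.GeneralLinearGroup.mkOfDetNeZero, Matrix.mul_apply, Matrix.mulVec, dotProduct,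
        Fin.sum_univ_two, sub_eq_add_neg, add_comm] using congrFun hXX i
  · ext i j
    fin_cases j
    · simpa [Matrix.GeneralLinearGroup.mkOfDetNeZero, Matrix.mul_apply, Matrix.mulVec, dotProduct,
        Fin.sum_univ_two] using congrFun hv.symm i
    · simpa [Matrix.GeneralLinearGroup.mkOfDetNeZero, Matrix.mul_apply, Matrix.mulVec, dotProduct,
        Fin.sum_univ_two] using congrFun hYv i

theorem matX_mk_ne_one : (matX F : PSL(2, F)) ≠ 1 := by
  rw [Ne, mk_eq_one_iff, not_or]
  constructor <;> intro h <;> simpa using congrArg (fun A : SL(2, F) => A.1 1 0) h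

theorem matY_mk_ne_one : (matY F : PSL(2, F)) ≠ 1 := by
  rw [Ne, mk_eq_one_iff, not_or]
  constructor <;> intro h <;> simpa using congrArg (fun A : SL(2, F) => A.1 1 0) h

theorem upper_one_mk_ne_one : (upper (1 : F) : PSL(2, F)) ≠ 1 := by
  rw [Ne, mk_eq_one_iff, not_or]
  constructor <;> intro h <;> simpa using congrArg (fun A : SL(2, F) => A.1 0 1) h

theorem matX_mk_pow : (matX F : PSL(2, F)) ^ 3 = 1 := by
  rw [← QuotientGroup.mk_pow, matX_pow_three, QuotientGroup.mk_one]

theorem matY_mk_pow : (matY F : PSL(2, F)) ^ 2 = 1 := by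
  rw [← QuotientGroup.mk_pow, pow_two, matY_sq, neg_mk, QuotientGroup.mk_one]

theorem orderOf_matX_mk : orderOf (matX F : PSL(2, F)) = 3 :=
  orderOf_eq_prime matX_mk_pow matX_mk_ne_one

theorem orderOf_matY_mk : orderOf (matY F : PSL(2, F)) = 2 :=
  orderOf_eq_prime matY_mk_pow matY_mk_ne_one

/-- With x trivial the group would be generated by y and have exponent dividing 2, but `matX` gives
an element of order 3. -/
theorem fst_ne_one_of_closure {x y : PSL(2, F)} (hy : y ^ 2 = 1)
    (h : Subgroup.closure {x, y} = ⊤) : x ≠ 1 := by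
  rintro rfl
  rw [Subgroup.closure_insert_one, ← Subgroup.zpowers_eq_closure] at h
  obtain ⟨n, hn⟩ := Subgroup.mem_zpowers_iff.1 (h ▸ Subgroup.mem_top (matX F : PSL(2, F)))
  have h2 : (matX F : PSL(2, F)) ^ 2 = 1 := by
    rw [← hn, ← zpow_natCast, zpow_comm, zpow_natCast, hy, one_zpow]
  have := orderOf_dvd_of_pow_eq_one h2
  rw [orderOf_matX_mk] at this
  omega

theorem snd_ne_one_of_closure {x y : PSL(2, F)} (hx : x ^ 3 = 1)
    (h : Subgroup.closure {x, y} = ⊤) : y ≠ 1 := by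
  rintro rfl
  rw [Set.pair_comm, Subgroup.closure_insert_one, ← Subgroup.zpowers_eq_closure] at h
  obtain ⟨n, hn⟩ := Subgroup.mem_zpowers_iff.1 (h ▸ Subgroup.mem_top (matY F : PSL(2, F)))
  have h2 : (matY F : PSL(2, F)) ^ 3 = 1 := by
    rw [← hn, ← zpow_natCast, zpow_comm, zpow_natCast, hx, one_zpow]
  have := orderOf_dvd_of_pow_eq_one h2
  rw [orderOf_matY_mk] at this
  omega

end Field

section Prime

variable {p : ℕ} [Fact p.Prime]

/-- If W^p = r with r = ±1, then in characteristic p also (W - r)^p = W^p - r^p = 0, so W - r is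
singular. -/
theorem exists_eigenvector {W : SL(2, ZMod p)} (h : (W : PSL(2, ZMod p)) ^ p = 1) :
    ∃ u : Fin 2 → ZMod p, u ≠ 0 ∧ (W.1.mulVec u = u ∨ W.1.mulVec u = -u) := by
  have key : ∀ r : ZMod p, W.1 ^ p = r • 1 → ∃ u : Fin 2 → ZMod p, u ≠ 0 ∧ W.1.mulVec u = r • u := by
    intro r hr
    have hp : (W.1 - r • 1) ^ p = 0 := by
      rw [sub_pow_char_of_commute p ((Commute.one_right W.1).smul_right r), hr, smul_pow, one_pow,
        ZMod.pow_card, sub_self]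
    have hd : (W.1 - r • 1).det = 0 := by
      refine pow_eq_zero_iff (Fact.out : p.Prime).ne_zero |>.1 ?_
      rw [← Matrix.det_pow, hp, Matrix.det_zero]
    obtain ⟨u, hu, hWu⟩ := Matrix.exists_mulVec_eq_zero_iff.2 hd
    refine ⟨u, hu, ?_⟩
    rwa [Matrix.sub_mulVec, Matrix.smul_mulVec, Matrix.one_mulVec, sub_eq_zero] at hWu
  rw [← QuotientGroup.mk_pow, mk_eq_one_iff] at h
  rcases h with h | h
  · obtain ⟨u, hu, hWu⟩ := key 1 (by simpa using congrArg Subtype.val h)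
    exact ⟨u, hu, Or.inl (by simpa using hWu)⟩
  · obtain ⟨u, hu, hWu⟩ := key (-1) (by simpa using congrArg Subtype.val h)
    exact ⟨u, hu, Or.inr (by simpa using hWu)⟩

/-- The automorphisms of `PSL₂(p)` act transitively on the generating triples of type
`(3, 2, p)`. -/
theorem exists_mulEquiv_of_closure {x y : PSL(2, ZMod p)} (hx : x ^ 3 = 1) (hy : y ^ 2 = 1)
    (hz : (y * x) ^ p = 1) (h : Subgroup.closure {x, y} = ⊤) :
    ∃ α : PSL(2, ZMod p) ≃* PSL(2, ZMod p), α x = matX (ZMod p) ∧ α y = matY (ZMod p) := by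
  have hx1 := fst_ne_one_of_closure hy h
  have hy1 := snd_ne_one_of_closure hx h
  obtain ⟨X, rfl, hX⟩ := exists_lift_order_three hx hx1
  obtain ⟨Y, rfl⟩ := QuotientGroup.mk_surjective y
  have hY := coe_sq_of_mk_sq hy hy1
  rw [← QuotientGroup.mk_mul] at hz
  obtain ⟨u, hu, hW⟩ := exists_eigenvector hz
  rw [Matrix.SpecialLinearGroup.coe_mul] at hW
  rcases hW with hW | hW
  -- The sign of X is fixed by its quadratic equation, whereas Y² = -1 allows Y to be replaced by
  -- -Y, turning the eigenvalue 1 into -1.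
  · have hY' : (-Y).1 * (-Y).1 = -1 := by simpa using hY
    obtain ⟨g, hgX, hgY⟩ := exists_conj hX hY' hu (by simp [Matrix.neg_mulVec, hW])
    exact ⟨conjPSL g, conjPSL_mk hgX, by rw [← conjPSL_mk hgY, neg_mk]⟩
  · obtain ⟨g, hgX, hgY⟩ := exists_conj hX hY hu hW
    exact ⟨conjPSL g, conjPSL_mk hgX, conjPSL_mk hgY⟩

end Prime

end ModularDessin

/-! ### Dessins and their monodromy triples -/

namespace Dessin

/-- The rotation around the black vertices as an element of the monodromy group. -/
def xMon (D : Dessin.{u}) : D.monodromyGroup := ⟨D.x, Subgroup.subset_closure (by simp)⟩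

/-- The rotation around the white vertices as an element of the monodromy group. -/
def yMon (D : Dessin.{u}) : D.monodromyGroup := ⟨D.y, Subgroup.subset_closure (by simp)⟩

theorem closure_xMon_yMon (D : Dessin.{u}) : Subgroup.closure {D.xMon, D.yMon} = ⊤ := by
  have h := Subgroup.closure_closure_coe_preimage (k := ({D.x, D.y} : Set (Equiv.Perm D.E)))
  refine (congrArg Subgroup.closure ?_).trans h
  ext g
  change g = D.xMon ∨ g = D.yMon ↔ g.1 = D.x ∨ g.1 = D.y
  rw [Subtype.ext_iff, Subtype.ext_iff]
  rfl

theorem exists_monodromy (D : Dessin.{u}) (e e' : D.E) : ∃ g : D.monodromyGroup, g.1 e = e' :=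
  D.transitive.exists_smul_eq e e'

theorem autGroup_comm (D : Dessin.{u}) (g : D.monodromyGroup) (s : D.autGroup) (e : D.E) :
    g.1 (s.1 e) = s.1 (g.1 e) := by
  have h : D.monodromyGroup ≤ Subgroup.centralizer {s.1} := by
    rw [monodromyGroup, Subgroup.closure_le]
    intro t ht
    rw [SetLike.mem_coe, Subgroup.mem_centralizer_singleton_iff]
    exact Subgroup.mem_centralizer_iff.1 s.2 t ht
  exact congrArg (fun t : Equiv.Perm D.E => t e)
    (Subgroup.mem_centralizer_singleton_iff.1 (h g.2))

/-- The centralizer of a transitive group acts freely. For a regular dessin the next lemma applies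
this with the two groups exchanged. -/
theorem autGroup_free (D : Dessin.{u}) (e : D.E) {s t : D.autGroup} (h : s.1 e = t.1 e) :
    s = t := by
  ext e'
  obtain ⟨g, rfl⟩ := D.exists_monodromy e e'
  rw [← autGroup_comm, ← autGroup_comm, h]

theorem IsRegular.monodromy_free {D : Dessin.{u}} (hD : D.IsRegular) (e : D.E)
    {g k : D.monodromyGroup} (h : g.1 e = k.1 e) : g = k := by
  ext e'
  obtain ⟨s, rfl⟩ := hD.exists_smul_eq e e'
  change g.1 (s.1 e) = k.1 (s.1 e)
  rw [autGroup_comm, autGroup_comm, h]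

/-- The automorphism group of a regular dessin is isomorphic to its monodromy group. -/
theorem IsRegular.nonempty_mulEquiv {D : Dessin.{u}} (hD : D.IsRegular) :
    Nonempty (D.monodromyGroup ≃* D.autGroup) := by
  obtain ⟨e⟩ := D.nonempty
  -- The inverse is needed because the two actions commute: matching s with g by s e = g e would
  -- reverse products.
  have ex : ∀ g : D.monodromyGroup, ∃ s : D.autGroup, s.1 e = g⁻¹.1 e := fun g =>
    hD.exists_smul_eq e (g⁻¹.1 e)
  choose f hf using ex
  refine ⟨MulEquiv.ofBijective (MonoidHom.mk' f fun g k => D.autGroup_free e ?_) ⟨?_, ?_⟩⟩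
  · change _ = (f g).1 ((f k).1 e)
    rw [hf, hf, ← autGroup_comm, hf, mul_inv_rev]
    rfl
  · intro g k h
    refine inv_injective (hD.monodromy_free e ?_)
    rw [← hf, ← hf]
    exact congrArg (fun s : D.autGroup => s.1 e) h
  · intro s
    obtain ⟨g, hg⟩ := D.exists_monodromy e (s.1 e)
    refine ⟨g⁻¹, D.autGroup_free e ?_⟩
    change (f g⁻¹).1 e = s.1 e
    rw [hf, inv_inv, hg]

/-- A regular dessin is isomorphic to the minimal regular cover of any dessin with the same
monodromy triple. -/
theorem IsRegular.isomorphic_minimalRegularCover {R : Dessin.{u}} {D : Dessin.{v}}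
    (hR : R.IsRegular) (β : R.monodromyGroup ≃* D.monodromyGroup) (hx : β R.xMon = D.xMon)
    (hy : β R.yMon = D.yMon) : R.Isomorphic D.minimalRegularCover := by
  obtain ⟨e⟩ := R.nonempty
  -- Freeness and transitivity identify the edges of `R` with its monodromy group, acting on itself
  -- by left multiplication.
  have hbij : Function.Bijective fun g : R.monodromyGroup => g.1 e :=
    ⟨fun _ _ h => hR.monodromy_free e h, R.exists_monodromy e⟩
  let φ := Equiv.ofBijective _ hbij
  refine ⟨φ.symm.trans β.toEquiv, fun e' => ?_, fun e' => ?_⟩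
  · obtain ⟨g, rfl⟩ := φ.surjective e'
    have h : R.x (φ g) = φ (R.xMon * g) := rfl
    change β (φ.symm (R.x (φ g))) = D.xMon * β (φ.symm (φ g))
    rw [h, Equiv.symm_apply_apply, Equiv.symm_apply_apply, map_mul, hx]
  · obtain ⟨g, rfl⟩ := φ.surjective e'
    have h : R.y (φ g) = φ (R.yMon * g) := rfl
    change β (φ.symm (R.y (φ g))) = D.yMon * β (φ.symm (φ g))
    rw [h, Equiv.symm_apply_apply, Equiv.symm_apply_apply, map_mul, hy]

/-- Dessins of the same degree with the same monodromy triple are isomorphic if some stabilizer of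
the first is contained in some stabilizer of the second. -/
theorem isomorphic_of_stabilizer_le {D : Dessin.{u}} {D' : Dessin.{v}}
    (hdeg : D.degree = D'.degree) (β : D.monodromyGroup ≃* D'.monodromyGroup)
    (hx : β D.xMon = D'.xMon) (hy : β D.yMon = D'.yMon) (e : D.E) (e' : D'.E)
    (h : ∀ g : D.monodromyGroup, g.1 e = e → (β g).1 e' = e') : D.Isomorphic D' := by
  choose k hk using D.exists_monodromy e
  -- The rule g e ↦ β(g) e' does not depend on the choice of g, by the inclusion of stabilizers.
  have key : ∀ g : D.monodromyGroup, (β (k (g.1 e))).1 e' = (β g).1 e' := by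
    intro g
    have h1 : (g⁻¹ * k (g.1 e)).1 e = e := by
      change g.1⁻¹ ((k (g.1 e)).1 e) = e
      rw [hk, Equiv.Perm.inv_eq_iff_eq]
    have h2 := h _ h1
    rw [map_mul, map_inv] at h2
    change (β g).1⁻¹ ((β (k (g.1 e))).1 e') = e' at h2
    rwa [Equiv.Perm.inv_eq_iff_eq] at h2
  let f : D.E → D'.E := fun d => (β (k d)).1 e'
  have hf : ∀ g : D.monodromyGroup, f (g.1 e) = (β g).1 e' := key
  have hsurj : Function.Surjective f := by
    intro d
    obtain ⟨g, rfl⟩ := D'.exists_monodromy e' d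
    exact ⟨(β.symm g).1 e, by rw [hf, β.apply_symm_apply]⟩
  have := D.finite
  have := D'.finite
  have hbij : Function.Bijective f := hsurj.bijective_of_nat_card_le hdeg.le
  refine ⟨Equiv.ofBijective f hbij, fun d => ?_, fun d => ?_⟩
  · obtain ⟨g, rfl⟩ := D.exists_monodromy e d
    change f ((D.xMon * g).1 e) = D'.xMon.1 (f (g.1 e))
    rw [hf, hf, map_mul, hx]; rfl
  · obtain ⟨g, rfl⟩ := D.exists_monodromy e d
    change f ((D.yMon * g).1 e) = D'.yMon.1 (f (g.1 e))
    rw [hf, hf, map_mul, hy]; rfl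

/-- Left multiplication identifies the monodromy group with that of the minimal regular cover. -/
theorem nonempty_mulEquiv_minimalRegularCover (D : Dessin.{u}) :
    Nonempty (D.monodromyGroup ≃* D.minimalRegularCover.monodromyGroup) := by
  let L : D.monodromyGroup →* Equiv.Perm D.monodromyGroup :=
    MulAction.toPermHom D.monodromyGroup D.monodromyGroup
  have hL : Function.Injective L := MulAction.toPerm_injective
  have hrange : L.range = D.minimalRegularCover.monodromyGroup := by
    rw [MonoidHom.range_eq_map, ← closure_xMon_yMon, MonoidHom.map_closure, Set.image_pair]
    rfl
  exact ⟨(MonoidHom.ofInjective hL).trans (MulEquiv.subgroupCongr hrange)⟩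

theorem orderOf_minimalRegularCover (D : Dessin.{u}) :
    orderOf D.minimalRegularCover.x = orderOf D.x ∧ orderOf D.minimalRegularCover.y = orderOf D.y ∧
      orderOf D.minimalRegularCover.z = orderOf D.z := by
  let L : D.monodromyGroup →* Equiv.Perm D.monodromyGroup :=
    MulAction.toPermHom D.monodromyGroup D.monodromyGroup
  have hL : Function.Injective L := MulAction.toPerm_injective
  have h : ∀ g : D.monodromyGroup, orderOf (L g) = orderOf g.1 := fun g =>
    (orderOf_injective L hL g).trans (Subgroup.orderOf_coe g).symm
  refine ⟨h D.xMon, h D.yMon, ?_⟩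
  have hz := h (D.yMon * D.xMon)⁻¹
  rw [map_inv, map_mul] at hz
  exact hz

end Dessin

/-! ### The modular dessins and their uniqueness -/

namespace ModularDessin

open Dessin

variable (p : ℕ) [Fact p.Prime]

/-- The action of `SL₂(p)` on the edges of `𝒟₀(p)`. -/
def moebiusHom : SL(2, ZMod p) →* Equiv.Perm (ℙ (ZMod p) (Fin 2 → ZMod p)) :=
  MulAction.toPermHom _ _

theorem range_moebiusHom : (moebiusHom p).range = (modularDessinZero p).monodromyGroup := by
  rw [MonoidHom.range_eq_map, ← closure_matX_matY, MonoidHom.map_closure, Set.image_pair]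
  rfl

/-- The monodromy group of `𝒟₀(p)` is `PSL₂(p)`. -/
noncomputable def pslEquiv : PSL(2, ZMod p) ≃* (modularDessinZero p).monodromyGroup :=
  -- The kernel of the action on the projective line is the centre.
  (QuotientGroup.quotientMulEquivOfEq Projectivization.SL_mulAction_ker.symm).trans
    ((QuotientGroup.quotientKerEquivRange (moebiusHom p)).trans
      (MulEquiv.subgroupCongr (range_moebiusHom p)))

theorem coe_pslEquiv (A : SL(2, ZMod p)) : (pslEquiv p A).1 = moebiusPerm p A := rfl

theorem pslEquiv_matX : pslEquiv p (matX (ZMod p)) = (modularDessinZero p).xMon := rfl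

theorem pslEquiv_matY : pslEquiv p (matY (ZMod p)) = (modularDessinZero p).yMon := rfl

theorem z_eq : (modularDessinZero p).z = (pslEquiv p (upper (1 : ZMod p))).1 := by
  rw [← neg_mk, ← matY_mul_matX_inv, QuotientGroup.mk_inv, QuotientGroup.mk_mul, map_inv, map_mul,
    pslEquiv_matX, pslEquiv_matY]
  rfl

theorem orderOf_upper_mk : orderOf (upper (1 : ZMod p) : PSL(2, ZMod p)) = p := by
  refine orderOf_eq_prime ?_ upper_one_mk_ne_one
  rw [← QuotientGroup.mk_pow, upper_pow, CharP.cast_eq_zero, zero_mul, mk_eq_one_iff]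
  left
  ext i j; fin_cases i <;> fin_cases j <;> simp

theorem modularDessinZero_hasExactType : (modularDessinZero p).HasExactType 3 2 p := by
  have h : ∀ g : PSL(2, ZMod p), orderOf (pslEquiv p g).1 = orderOf g := fun g =>
    (Subgroup.orderOf_coe _).trans (orderOf_injective (pslEquiv p).toMonoidHom
      (pslEquiv p).injective g)
  refine ⟨(h (matX (ZMod p))).trans orderOf_matX_mk, (h (matY (ZMod p))).trans orderOf_matY_mk, ?_⟩
  rw [z_eq, h, orderOf_upper_mk]

theorem modularDessin_hasExactType : (modularDessin p).HasExactType 3 2 p := by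
  obtain ⟨h1, h2, h3⟩ := modularDessinZero_hasExactType p
  obtain ⟨k1, k2, k3⟩ := orderOf_minimalRegularCover (modularDessinZero p)
  exact ⟨k1.trans h1, k2.trans h2, k3.trans h3⟩

theorem modularDessinZero_degree : (modularDessinZero p).degree = p + 1 := by
  refine (Projectivization.card_of_finrank_two (ZMod p) (Fin 2 → ZMod p) (by simp)).trans ?_
  rw [Nat.card_zmod]

theorem hasType_of_hasExactType {D : Dessin.{u}} {l m n : ℕ} (h : D.HasExactType l m n) :
    D.HasType l m n :=
  ⟨h.1.dvd, h.2.1.dvd, h.2.2.dvd⟩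

variable {p}

/-- A dessin of type `(3, 2, p)` with monodromy group `PSL₂(p)` has the monodromy triple of
`𝒟₀(p)`, up to isomorphism. -/
theorem exists_monodromy_equiv {D : Dessin.{u}} (hD : D.HasType 3 2 p)
    (f : D.monodromyGroup ≃* PSL(2, ZMod p)) :
    ∃ β : D.monodromyGroup ≃* (modularDessinZero p).monodromyGroup,
      β D.xMon = (modularDessinZero p).xMon ∧ β D.yMon = (modularDessinZero p).yMon := by
  obtain ⟨hx, hy, hz⟩ := hD
  have hx' : D.xMon ^ 3 = 1 := Subtype.ext (orderOf_dvd_iff_pow_eq_one.1 hx)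
  have hy' : D.yMon ^ 2 = 1 := Subtype.ext (orderOf_dvd_iff_pow_eq_one.1 hy)
  have hz' : (D.yMon * D.xMon) ^ p = 1 := by
    rw [Dessin.z, orderOf_inv] at hz
    exact Subtype.ext (orderOf_dvd_iff_pow_eq_one.1 hz)
  obtain ⟨α, hαx, hαy⟩ := exists_mulEquiv_of_closure (x := f D.xMon) (y := f D.yMon)
    (by rw [← map_pow, hx', map_one]) (by rw [← map_pow, hy', map_one])
    (by rw [← map_mul, ← map_pow, hz', map_one]) (by
      rw [← Set.image_pair, ← MulEquiv.coe_toMonoidHom, ← MonoidHom.map_closure,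
        closure_xMon_yMon]
      exact Subgroup.map_top_of_surjective _ f.surjective)
  refine ⟨(f.trans α).trans (pslEquiv p), ?_, ?_⟩
  · rw [← pslEquiv_matX, ← hαx]; rfl
  · rw [← pslEquiv_matY, ← hαy]; rfl

theorem infinity_ne_zero : (![1, 0] : Fin 2 → ZMod p) ≠ 0 := fun h => by simpa using congrFun h 0

theorem moebiusPerm_infinity {A : SL(2, ZMod p)} (h : A.1 1 0 = 0) :
    moebiusPerm p A (Projectivization.mk _ ![1, 0] infinity_ne_zero) =
      Projectivization.mk _ ![1, 0] infinity_ne_zero := by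
  refine (Projectivization.mk_eq_mk_iff' (ZMod p) (A.1.mulVec ![1, 0]) _ _ _).2 ⟨A.1 0 0, ?_⟩
  ext i
  fin_cases i <;> simp [Matrix.mulVec, dotProduct, Fin.sum_univ_two, h]

/-- A permutation whose order divides `p` has a fixed point on a set of `p + 1` elements. -/
theorem exists_fixed_point {E : Type*} [Finite E] (hE : Nat.card E = p + 1) {σ : Equiv.Perm E}
    (hσ : orderOf σ ∣ p) : ∃ e, σ e = e := by
  classical
  have := Fintype.ofFinite E
  by_contra! hne
  let τ : Function.End E := MulAction.toEndHom σ
  have hpow : τ ^ p ^ 1 = 1 := by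
    rw [pow_one, ← map_pow, orderOf_dvd_iff_pow_eq_one.1 hσ, map_one]
  have hempty : IsEmpty (Function.fixedPoints τ) := ⟨fun e => hne e.1 e.2⟩
  -- The number of fixed points is congruent mod p to |E| = p + 1, so it cannot be zero.
  have hmod : Fintype.card E ≡ 0 [MOD p] := (Equiv.Perm.card_fixedPoints_modEq hpow).trans
    (congrArg (· % p) (Fintype.card_eq_zero_iff.2 hempty))
  rw [← Nat.card_eq_fintype_card, hE,
    Nat.modEq_zero_iff_dvd, Nat.dvd_add_right dvd_rfl] at hmod
  exact (Fact.out : p.Prime).one_lt.ne' (Nat.dvd_one.1 hmod)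

theorem isomorphic_modularDessinZero {D : Dessin.{u}} (hdeg : D.degree = p + 1)
    (hD : D.HasType 3 2 p) (f : D.monodromyGroup ≃* PSL(2, ZMod p)) :
    D.Isomorphic (modularDessinZero p) := by
  have := D.finite
  obtain ⟨β, hx, hy⟩ := exists_monodromy_equiv hD f
  obtain ⟨e, he⟩ := exists_fixed_point hdeg hD.2.2
  refine isomorphic_of_stabilizer_le (hdeg.trans (modularDessinZero_degree p).symm) β hx hy e
    (Projectivization.mk _ ![1, 0] infinity_ne_zero) fun g hg => ?_
  -- SL₂(p) acts on the edges of `D` through β⁻¹, so the stabilizer of e can be studied as a group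
  -- `K` of matrices.
  let γ : SL(2, ZMod p) →* Equiv.Perm D.E :=
    D.monodromyGroup.subtype.comp ((((pslEquiv p).trans β.symm).toMonoidHom).comp
      (QuotientGroup.mk' _))
  have hγ : ∀ A : SL(2, ZMod p), γ A = (β.symm (pslEquiv p A)).1 := fun _ => rfl
  let K : Subgroup SL(2, ZMod p) := (MulAction.stabilizer (Equiv.Perm D.E) e).comap γ
  have hK : ∀ A : SL(2, ZMod p), A ∈ K ↔ γ A e = e := fun _ => Iff.rfl
  have hupper : upper 1 ∈ K := by
    rw [hK, hγ]
    have hz : pslEquiv p (upper (1 : ZMod p)) = β (D.yMon * D.xMon)⁻¹ := by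
      rw [map_inv, map_mul, hx, hy]
      exact Subtype.ext (z_eq p).symm
    rw [hz, β.symm_apply_apply]
    exact he
  obtain ⟨a, ha⟩ := (pslEquiv p).surjective (β g)
  obtain ⟨A, rfl⟩ := QuotientGroup.mk_surjective a
  have hAK : A ∈ K := by
    rw [hK, hγ, ha, β.symm_apply_apply, hg]
  rw [← ha, coe_pslEquiv]
  refine moebiusPerm_infinity ?_
  -- An element of `K` moving ∞ would, with the translation, generate SL₂(p). Then e would be the
  -- only edge, although there are p + 1 > 1.
  by_contra hA0
  have htop := eq_top_of_upper_one_mem hupper hAK hA0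
  have hfix : ∀ d : D.E, d = e := by
    intro d
    obtain ⟨k, rfl⟩ := D.exists_monodromy e d
    obtain ⟨b, hb⟩ := (pslEquiv p).surjective (β k)
    obtain ⟨B, rfl⟩ := QuotientGroup.mk_surjective b
    have hB : γ B e = e := (hK B).1 (htop ▸ Subgroup.mem_top B)
    rwa [hγ, hb, β.symm_apply_apply] at hB
  have : Subsingleton D.E := ⟨fun a b => (hfix a).trans (hfix b).symm⟩
  have hle : Nat.card D.E ≤ 1 := Finite.card_le_one_iff_subsingleton.2 this
  have hpos := (Fact.out : p.Prime).pos
  rw [Dessin.degree] at hdeg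
  omega

end ModularDessin

open ModularDessin in
theorem mainTheorem7 (p : ℕ) [Fact p.Prime] :
    ((modularDessin p).IsRegular ∧
      (modularDessin p).HasType 3 2 p ∧
      (modularDessin p).HasExactType 3 2 p ∧
      Nonempty ((modularDessin p).autGroup ≃* PSL(2, ZMod p)) ∧
      ∀ R : Dessin.{u}, R.IsRegular → R.HasType 3 2 p →
        Nonempty (R.autGroup ≃* PSL(2, ZMod p)) → R.Isomorphic (modularDessin p)) ∧
    ((modularDessinZero p).degree = p + 1 ∧
      (modularDessinZero p).HasType 3 2 p ∧
      (modularDessinZero p).HasExactType 3 2 p ∧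
      Nonempty ((modularDessinZero p).monodromyGroup ≃* PSL(2, ZMod p)) ∧
      ∀ D : Dessin.{u}, D.degree = p + 1 → D.HasType 3 2 p →
        Nonempty (D.monodromyGroup ≃* PSL(2, ZMod p)) → D.Isomorphic (modularDessinZero p)) := by
  have hreg : (modularDessin p).IsRegular := Dessin.minimalRegularCover_isRegular _
  refine ⟨⟨hreg, hasType_of_hasExactType (modularDessin_hasExactType p),
    modularDessin_hasExactType p, ?_, ?_⟩, modularDessinZero_degree p,
    hasType_of_hasExactType (modularDessinZero_hasExactType p), modularDessinZero_hasExactType p,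
    ⟨(pslEquiv p).symm⟩, fun D hdeg hD ⟨f⟩ => isomorphic_modularDessinZero hdeg hD f⟩
  · obtain ⟨f⟩ := hreg.nonempty_mulEquiv
    obtain ⟨g⟩ := (modularDessinZero p).nonempty_mulEquiv_minimalRegularCover
    exact ⟨((pslEquiv p).trans (g.trans f)).symm⟩
  · rintro R hR hT ⟨f⟩
    -- Regularity turns the hypothesis on the automorphism group into one on the monodromy group.
    obtain ⟨g⟩ := hR.nonempty_mulEquiv
    obtain ⟨β, hx, hy⟩ := exists_monodromy_equiv hT (g.trans f)
    exact hR.isomorphic_minimalRegularCover β hx hy
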